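/- Let $\pi$ be a discrete group, and let $p\colon E\pi\to B\pi$ be the universal covering of a (Hausdorff) classifying space of $\pi$, where $E\pi$ is the geometric realization, with the weak topology, of a simplicial complex on which $\pi$ acts by simplicial automorphisms; thus $E\pi$ is contractible and $p$ is the quotient covering for the free action of $\pi$. Choose one vertex $x_i$ from each $\pi$-orbit of vertices, so that every vertex of $E\pi$ has a unique expression $h x_i$ with $h\in\pi$. Let $V$ be a finite-dimensional complex Hermitian space and let $\rho=(T,\Phi)$ be the Fredholm representation of $\pi$ on $H=\bigoplus_{g\in\pi}V_g$, $V_g=V$, where $T_h$ maps $V_g$ identically onto $V_{hg}$ and $\Phi$ is the block-diagonal operator given by linear maps $F(g)\colon V\to V$, $g\in\pi$, such that 1. there is a constant $C$ such that, for all $g$ outside a finite subset of $\pi$, $F(g)$ is invertible, $\|F(g)\|\le C$ and $\|F(g)^{-1}\|\le C$; 2. for every $h\in\pi$, $\|F(g)-F(hg)\|\to 0$ as $g\to\infty$ in $\pi$ (that is, as $g$ leaves every finite subset). For a point $x=\sum_{k=0}^n\lambda_k h_k x_{i_k}$ of a simplex with vertices $h_0x_{i_0},\dots,h_nx_{i_n}$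 (barycentric coordinates $\lambda_k$) put $$F_x=\sum_{k=0}^n\lambda_k F(h_k^{-1})\colon V\to V .$$ For a locally compact Hausdorff space $Y$ let $K^0_c(Y)$ be complex $K$-theory with compact supports: the abelian group generated by the triples $(E_0,E_1,\alpha)$, where $E_0,E_1$ are complex vector bundles over $Y$ and $\alpha\colon E_0\to E_1$ is a bundle homomorphism which is an isomorphism outside a compact set, modulo isomorphism, direct sums, homotopy, and triples with $\alpha$ an isomorphism everywhere. Let $$\mathcal K^0(E\pi)=\varprojlim_X K^0_c(p^{-1}(X)),$$ the inverse limit over the compact subsets $X\subset B\pi$ with respect to restriction. Then $x\mapsto F_x$ is continuous; for every compact $X\subset B\pi$ the map $F_x$ is invertible for all $x\in p^{-1}(X)$ outside a compact subset of $p^{-1}(X)$; and the classes $$[\,p^{-1}(X)\times V,\ p^{-1}(X)\times V,\ F_x\,]\in K^0_c(p^{-1}(X))$$ are compatible with restriction. Hence the map $F\colon E\pi\times V\to E\pi\times V$, $(x,\xi)\mapsto (x,F_x\xi)$, defines a (unique) element $F(\rho)\in\mathcal K^0(E\pi)$ whose component at each compact $X$ is this class. -/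

import Mathlib

open Topology Filter

universe u u' w

noncomputable section

namespace FredholmK

/-! ### Complex vector bundles, given by compatible atlases of continuous local frames -/

/-- A (locally trivial, finite rank) complex vector bundle over a topological space `Y`: a family of
complex vector spaces together with an open cover `U i` and frames over the `U i` whose transition
matrices are continuous. The rank `rk i` may vary from one chart to another. -/
structure VBundle (Y : Type u) [TopologicalSpace Y] : Type (max (u + 1) (w + 1)) where
  fiber : Y → Type w
  [addCommGroup : ∀ y, AddCommGroup (fiber y)]
  [module : ∀ y, Module ℂ (fiber y)]
  ι : Type u
  U : ι → Set Y
  isOpen_U : ∀ i, IsOpen (U i)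
  cover : ∀ y, ∃ i, y ∈ U i
  rk : ι → ℕ
  frame : ∀ i y, y ∈ U i → Module.Basis (Fin (rk i)) ℂ (fiber y)
  continuous_transition : ∀ i j, Continuous fun y : {y // y ∈ U i ∧ y ∈ U j} =>
    (frame i y.1 y.2.1).toMatrix (frame j y.1 y.2.2)

attribute [instance] VBundle.addCommGroup VBundle.module

lemma continuous_toMatrix_iff {X : Type*} [TopologicalSpace X] {n m : ℕ} {M N : X → Type w}
    [∀ x, AddCommGroup (M x)] [∀ x, Module ℂ (M x)] [∀ x, AddCommGroup (N x)]
    [∀ x, Module ℂ (N x)] (b : ∀ x, Module.Basis (Fin n) ℂ (M x))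
    (c : ∀ x, Module.Basis (Fin m) ℂ (N x)) (φ : ∀ x, M x →ₗ[ℂ] N x) :
    (Continuous fun x => LinearMap.toMatrix (b x) (c x) (φ x)) ↔
      ∀ i j, Continuous fun x => (c x).repr (φ x (b x j)) i := by
  refine ⟨fun h i j => ?_, fun h => continuous_matrix fun i j => ?_⟩
  · simpa [LinearMap.toMatrix_apply] using h.matrix_elem i j
  · simpa [LinearMap.toMatrix_apply] using h i j

lemma repr_prodMap {M M' N N' : Type w} [AddCommGroup M] [AddCommGroup M'] [AddCommGroup N]
    [AddCommGroup N'] [Module ℂ M] [Module ℂ M'] [Module ℂ N] [Module ℂ N'] {m m' n n' : ℕ}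
    (b : Module.Basis (Fin m) ℂ M) (b' : Module.Basis (Fin m') ℂ M')
    (c : Module.Basis (Fin n) ℂ N) (c' : Module.Basis (Fin n') ℂ N')
    (φ : M →ₗ[ℂ] N) (φ' : M' →ₗ[ℂ] N') (i : Fin n ⊕ Fin n') (j : Fin m ⊕ Fin m') :
    ((c.prod c').reindex finSumFinEquiv).repr
      ((φ.prodMap φ') (((b.prod b').reindex finSumFinEquiv) (finSumFinEquiv j)))
      (finSumFinEquiv i) =
    Matrix.fromBlocks (Matrix.of fun i j => c.repr (φ (b j)) i) 0 0
      (Matrix.of fun i j => c'.repr (φ' (b' j)) i) i j := by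
  rcases i with i | i <;> rcases j with j | j <;> simp

/-- A continuous homomorphism of vector bundles over the identity of the base: a family of
linear maps with continuous matrices in the local frames. -/
structure VBundle.Hom {Y : Type u} [TopologicalSpace Y] (E E' : VBundle.{u, w} Y) where
  toFun : ∀ y, E.fiber y →ₗ[ℂ] E'.fiber y
  continuous_matrix : ∀ i j, Continuous fun y : {y // y ∈ E.U i ∧ y ∈ E'.U j} =>
    LinearMap.toMatrix (E.frame i y.1 y.2.1) (E'.frame j y.1 y.2.2) (toFun y.1)

/-- The product bundle `Y × V`. -/
def VBundle.trivial (Y : Type u) [TopologicalSpace Y] (V : Type w) [AddCommGroup V] [Module ℂ V]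
    [FiniteDimensional ℂ V] : VBundle.{u, w} Y where
  fiber _ := V
  ι := PUnit
  U _ := Set.univ
  isOpen_U _ := isOpen_univ
  cover _ := ⟨PUnit.unit, Set.mem_univ _⟩
  rk _ := Module.finrank ℂ V
  frame _ _ _ := Module.finBasis ℂ V
  continuous_transition _ _ := continuous_const

/-- The direct sum of vector bundles. -/
def VBundle.sum {Y : Type u} [TopologicalSpace Y] (E E' : VBundle.{u, w} Y) :
    VBundle.{u, w} Y where
  fiber y := E.fiber y × E'.fiber y
  ι := E.ι × E'.ι
  U i := E.U i.1 ∩ E'.U i.2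
  isOpen_U i := (E.isOpen_U i.1).inter (E'.isOpen_U i.2)
  cover y := by
    obtain ⟨i, hi⟩ := E.cover y
    obtain ⟨j, hj⟩ := E'.cover y
    exact ⟨(i, j), hi, hj⟩
  rk i := E.rk i.1 + E'.rk i.2
  frame i y hy := ((E.frame i.1 y hy.1).prod (E'.frame i.2 y hy.2)).reindex finSumFinEquiv
  continuous_transition i j := by
    have h1 := (E.continuous_transition i.1 j.1).comp
      (f := fun y : {y // y ∈ E.U i.1 ∩ E'.U i.2 ∧ y ∈ E.U j.1 ∩ E'.U j.2} =>
        ⟨y.1, y.2.1.1, y.2.2.1⟩) (by fun_prop)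
    have h2 := (E'.continuous_transition i.2 j.2).comp
      (f := fun y : {y // y ∈ E.U i.1 ∩ E'.U i.2 ∧ y ∈ E.U j.1 ∩ E'.U j.2} =>
        ⟨y.1, y.2.1.2, y.2.2.2⟩) (by fun_prop)
    refine continuous_matrix fun a b => ?_
    obtain ⟨a, rfl⟩ := finSumFinEquiv.surjective a
    obtain ⟨b, rfl⟩ := finSumFinEquiv.surjective b
    rcases a with a | a <;> rcases b with b | b
    · simpa [Module.Basis.toMatrix_apply] using h1.matrix_elem a b
    · simpa [Module.Basis.toMatrix_apply] using continuous_const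
    · simpa [Module.Basis.toMatrix_apply] using continuous_const
    · simpa [Module.Basis.toMatrix_apply] using h2.matrix_elem a b

/-- The pull-back of a vector bundle along a continuous map. -/
def VBundle.pullback {Y : Type u} {Z : Type u} [TopologicalSpace Y] [TopologicalSpace Z]
    (f : C(Z, Y)) (E : VBundle.{u, w} Y) : VBundle.{u, w} Z where
  fiber z := E.fiber (f z)
  ι := E.ι
  U i := f ⁻¹' E.U i
  isOpen_U i := (E.isOpen_U i).preimage f.continuous
  cover z := E.cover (f z)
  rk := E.rk
  frame i z hz := E.frame i (f z) hz
  continuous_transition i j := by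
    have h : Continuous fun z : {z // z ∈ f ⁻¹' E.U i ∧ z ∈ f ⁻¹' E.U j} =>
      (⟨f z.1, z.2.1, z.2.2⟩ : {y // y ∈ E.U i ∧ y ∈ E.U j}) := by fun_prop
    exact (E.continuous_transition i j).comp h

/-- The direct sum of two bundle homomorphisms. -/
def VBundle.Hom.sum {Y : Type u} [TopologicalSpace Y] {E₀ E₁ E₀' E₁' : VBundle.{u, w} Y}
    (a : E₀.Hom E₁) (a' : E₀'.Hom E₁') : (E₀.sum E₀').Hom (E₁.sum E₁') where
  toFun y := (a.toFun y).prodMap (a'.toFun y)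
  continuous_matrix i j := by
    have h1 := ((continuous_toMatrix_iff _ _ _).1 (a.continuous_matrix i.1 j.1))
    have h2 := ((continuous_toMatrix_iff _ _ _).1 (a'.continuous_matrix i.2 j.2))
    have e1 : Continuous fun y : {y // y ∈ E₀.U i.1 ∩ E₀'.U i.2 ∧ y ∈ E₁.U j.1 ∩ E₁'.U j.2} =>
      (⟨y.1, y.2.1.1, y.2.2.1⟩ : {y // y ∈ E₀.U i.1 ∧ y ∈ E₁.U j.1}) := by fun_prop
    have e2 : Continuous fun y : {y // y ∈ E₀.U i.1 ∩ E₀'.U i.2 ∧ y ∈ E₁.U j.1 ∩ E₁'.U j.2} =>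
      (⟨y.1, y.2.1.2, y.2.2.2⟩ : {y // y ∈ E₀'.U i.2 ∧ y ∈ E₁'.U j.2}) := by fun_prop
    refine (continuous_toMatrix_iff _ _ _).2 fun b c => ?_
    obtain ⟨b, rfl⟩ := finSumFinEquiv.surjective b
    obtain ⟨c, rfl⟩ := finSumFinEquiv.surjective c
    refine Continuous.congr ?_ fun y => (repr_prodMap _ _ _ _ _ _ b c).symm
    rcases b with b | b <;> rcases c with c | c
    · exact (h1 b c).comp e1
    · exact continuous_const
    · exact continuous_const
    · exact (h2 b c).comp e2

/-- The pull-back of a bundle homomorphism. -/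
def VBundle.Hom.pullback {Y : Type u} {Z : Type u} [TopologicalSpace Y] [TopologicalSpace Z]
    (f : C(Z, Y)) {E E' : VBundle.{u, w} Y} (a : E.Hom E') :
    (E.pullback f).Hom (E'.pullback f) where
  toFun z := a.toFun (f z)
  continuous_matrix i j := by
    have h : Continuous fun z : {z // z ∈ f ⁻¹' E.U i ∧ z ∈ f ⁻¹' E'.U j} =>
      (⟨f z.1, z.2.1, z.2.2⟩ : {y // y ∈ E.U i ∧ y ∈ E'.U j}) := by fun_prop
    exact (a.continuous_matrix i j).comp h

/-- A continuous map `Y → End V`, regarded as an endomorphism of the product bundle `Y × V`. -/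
def VBundle.Hom.ofMap {Y : Type u} [TopologicalSpace Y] {V : Type w} [NormedAddCommGroup V]
    [NormedSpace ℂ V] [FiniteDimensional ℂ V] (A : C(Y, V →L[ℂ] V)) :
    (VBundle.trivial Y V).Hom (VBundle.trivial Y V) where
  toFun y := (A y : V →ₗ[ℂ] V)
  continuous_matrix i j := by
    refine (continuous_toMatrix_iff _ _ _).2 fun b c => ?_
    have h : Continuous ((Module.finBasis ℂ V).coord b) :=
      LinearMap.continuous_of_finiteDimensional _
    have h2 : Continuous fun y : {y : Y // y ∈ (Set.univ : Set Y) ∧ y ∈ (Set.univ : Set Y)} =>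
        A y.1 (Module.finBasis ℂ V c) := by fun_prop
    exact h.comp h2

/-! ### K-theory with compact supports -/

/-- A triple `(E₀, E₁, α)` with `α : E₀ → E₁` a bundle homomorphism which is an isomorphism on the
fibres outside some compact subset of the base. -/
structure Triple (Y : Type u) [TopologicalSpace Y] : Type (max (u + 1) (w + 1)) where
  E₀ : VBundle.{u, w} Y
  E₁ : VBundle.{u, w} Y
  α : E₀.Hom E₁
  compact_support : ∃ K : Set Y, IsCompact K ∧ ∀ y ∉ K, Function.Bijective (α.toFun y)

namespace Triple

variable {Y : Type u} {Z : Type u} [TopologicalSpace Y] [TopologicalSpace Z]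

/-- Isomorphism of triples. -/
def Iso (t t' : Triple.{u, w} Y) : Prop :=
  ∃ (φ₀ : t.E₀.Hom t'.E₀) (φ₁ : t.E₁.Hom t'.E₁),
    (∀ y, Function.Bijective (φ₀.toFun y)) ∧ (∀ y, Function.Bijective (φ₁.toFun y)) ∧
    ∀ y, t'.α.toFun y ∘ₗ φ₀.toFun y = φ₁.toFun y ∘ₗ t.α.toFun y

/-- A triple is acyclic if its homomorphism is an isomorphism everywhere. -/
def Acyclic (t : Triple.{u, w} Y) : Prop := ∀ y, Function.Bijective (t.α.toFun y)

/-- The direct sum of triples. -/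
def sum (t t' : Triple.{u, w} Y) : Triple.{u, w} Y where
  E₀ := t.E₀.sum t'.E₀
  E₁ := t.E₁.sum t'.E₁
  α := t.α.sum t'.α
  compact_support := by
    obtain ⟨K, hK, h⟩ := t.compact_support
    obtain ⟨K', hK', h'⟩ := t'.compact_support
    refine ⟨K ∪ K', hK.union hK', fun y hy => ?_⟩
    rw [Set.mem_union, not_or] at hy
    exact Function.Bijective.prodMap (h y hy.1) (h' y hy.2)

/-- The pull-back of a triple along a proper map. -/
def pullback (f : C(Z, Y)) (hf : IsProperMap f) (t : Triple.{u, w} Y) : Triple.{u, w} Z where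
  E₀ := t.E₀.pullback f
  E₁ := t.E₁.pullback f
  α := t.α.pullback f
  compact_support := by
    obtain ⟨K, hK, h⟩ := t.compact_support
    exact ⟨f ⁻¹' K, hf.isCompact_preimage hK, fun z hz => h (f z) hz⟩

/-- The triple `(Y × V, Y × V, A)` of a continuous family `A : Y → End V` which is invertible
outside a compact set. -/
def ofMap {V : Type w} [NormedAddCommGroup V] [NormedSpace ℂ V] [FiniteDimensional ℂ V]
    (A : C(Y, V →L[ℂ] V))
    (hA : ∃ K : Set Y, IsCompact K ∧ ∀ y ∉ K, Function.Bijective (A y)) : Triple.{u, w} Y where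
  E₀ := VBundle.trivial Y V
  E₁ := VBundle.trivial Y V
  α := VBundle.Hom.ofMap A
  compact_support := hA

end Triple

/-- The inclusion `y ↦ (y, t)` of `Y` in the cylinder `Y × [0, 1]`. -/
def slice (Y : Type u) [TopologicalSpace Y] (t : unitInterval) : C(Y, Y × unitInterval) :=
  ⟨fun y => (y, t), by fun_prop⟩

lemma isProperMap_slice (Y : Type u) [TopologicalSpace Y] (t : unitInterval) :
    IsProperMap (slice Y t) := by
  refine IsClosedEmbedding.isProperMap ⟨isEmbedding_prodMkLeft t, ?_⟩
  have : Set.range (slice Y t) = Prod.snd ⁻¹' {t} := by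
    ext ⟨y, s⟩
    simp [slice, eq_comm]
  rw [this]
  exact isClosed_singleton.preimage continuous_snd

/-- The defining relations of K-theory with compact supports, written as elements of the free
abelian group on triples: isomorphism, additivity, vanishing of acyclic triples, homotopy. -/
inductive Rel (Y : Type u) [TopologicalSpace Y] : FreeAbelianGroup (Triple.{u, w} Y) → Prop
  | iso (t t' : Triple.{u, w} Y) (h : t.Iso t') :
      Rel Y (FreeAbelianGroup.of t - FreeAbelianGroup.of t')
  | sum (t t' : Triple.{u, w} Y) :
      Rel Y (FreeAbelianGroup.of (t.sum t') - FreeAbelianGroup.of t - FreeAbelianGroup.of t')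
  | acyclic (t : Triple.{u, w} Y) (h : t.Acyclic) : Rel Y (FreeAbelianGroup.of t)
  | homotopy (t : Triple.{u, w} (Y × unitInterval)) :
      Rel Y (FreeAbelianGroup.of (t.pullback (slice Y 0) (isProperMap_slice Y 0)) -
        FreeAbelianGroup.of (t.pullback (slice Y 1) (isProperMap_slice Y 1)))

/-- `K⁰_c(Y)`, complex K-theory with compact supports of a locally compact space `Y`: the abelian
group generated by the triples `(E₀, E₁, α)` with compact support, modulo `Rel`. -/
abbrev Kc (Y : Type u) [TopologicalSpace Y] : Type (max (u + 1) (w + 1)) :=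
  FreeAbelianGroup (Triple.{u, w} Y) ⧸ AddSubgroup.closure {x | Rel.{u, w} Y x}

/-- The class `[E₀, E₁, α]` in `K⁰_c(Y)`. -/
def Kc.mk {Y : Type u} [TopologicalSpace Y] (t : Triple.{u, w} Y) : Kc.{u, w} Y :=
  QuotientAddGroup.mk (FreeAbelianGroup.of t)

/-- Functoriality of `K⁰_c` under proper maps, `f^*[E₀, E₁, α] = [f^*E₀, f^*E₁, f^*α]`. -/
def Kc.map {Y Z : Type u} [TopologicalSpace Y] [TopologicalSpace Z] (f : C(Z, Y))
    (hf : IsProperMap f) : Kc.{u, w} Y →+ Kc.{u, w} Z :=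
  QuotientAddGroup.map _ _ (FreeAbelianGroup.map (Triple.pullback f hf)) (by
    rw [AddSubgroup.closure_le]
    rintro x (hx : Rel Y x)
    apply AddSubgroup.subset_closure
    change Rel Z _
    cases hx with
    | iso t t' h =>
      obtain ⟨φ₀, φ₁, h₀, h₁, h⟩ := h
      simpa using Rel.iso (t.pullback f hf) (t'.pullback f hf)
        ⟨φ₀.pullback f, φ₁.pullback f, fun z => h₀ (f z), fun z => h₁ (f z), fun z => h (f z)⟩
    | sum t t' =>
      rw [map_sub, map_sub]
      exact Rel.sum (t.pullback f hf) (t'.pullback f hf)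
    | acyclic t h => simpa using Rel.acyclic (t.pullback f hf) fun z => h (f z)
    | homotopy t =>
      rw [map_sub]
      exact Rel.homotopy (t.pullback (f.prodMap (ContinuousMap.id unitInterval))
        (hf.prodMap isProperMap_id)))

lemma Kc.map_mk {Y Z : Type u} [TopologicalSpace Y] [TopologicalSpace Z] (f : C(Z, Y))
    (hf : IsProperMap f) (t : Triple.{u, w} Y) :
    Kc.map f hf (Kc.mk t) = Kc.mk (t.pullback f hf) := by
  simp [Kc.map, Kc.mk]

/-! ### The inverse limit over the compact subsets of the base -/

section Limit

variable {E : Type u} {B : Type u'} [TopologicalSpace E] [TopologicalSpace B]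

/-- The inclusion `p⁻¹(X) → p⁻¹(X')` for `X ⊆ X'`. -/
def preimageInclusion (p : C(E, B)) {X X' : TopologicalSpace.Compacts B} (h : X ≤ X') :
    C(p ⁻¹' (X : Set B), p ⁻¹' (X' : Set B)) :=
  ⟨Set.inclusion (Set.preimage_mono (SetLike.coe_subset_coe.2 h)), continuous_inclusion _⟩

lemma isProperMap_preimageInclusion [T2Space B] (p : C(E, B)) {X X' : TopologicalSpace.Compacts B}
    (h : X ≤ X') : IsProperMap (preimageInclusion p h) := by
  refine IsClosedEmbedding.isProperMap ⟨Topology.IsEmbedding.inclusion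
    (Set.preimage_mono (SetLike.coe_subset_coe.2 h)), ?_⟩
  have : Set.range (preimageInclusion p h) = Subtype.val ⁻¹' (p ⁻¹' (X : Set B)) := by
    exact Set.range_inclusion (Set.preimage_mono (SetLike.coe_subset_coe.2 h))
  rw [this]
  exact (X.isCompact.isClosed.preimage p.continuous).preimage continuous_subtype_val

/-- `𝒦⁰(E) = lim K⁰_c(p⁻¹(X))`, the inverse limit over the compact subsets `X` of `B` with respect
to the restriction homomorphisms: the group of compatible families. -/
def KLim [T2Space B] (p : C(E, B)) :
    AddSubgroup (∀ X : TopologicalSpace.Compacts B, Kc.{u, w} (p ⁻¹' (X : Set B))) where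
  carrier := {κ | ∀ (X X' : TopologicalSpace.Compacts B) (h : X ≤ X'),
    Kc.map (preimageInclusion p h) (isProperMap_preimageInclusion p h) (κ X') = κ X}
  zero_mem' X X' h := map_zero _
  add_mem' ha hb X X' h := by simp [ha X X' h, hb X X' h]
  neg_mem' ha X X' h := by simp [ha X X' h]

end Limit

/-! ### Simplicial complexes with a group action -/

/-- An abstract simplicial complex with vertex set `W` which is invariant under the action of the
group `Γ` on `W`. -/
structure GComplex (Γ : Type*) (W : Type u) [Group Γ] [MulAction Γ W] extends
    AbstractSimplicialComplex W where
  smul_mem : ∀ (g : Γ), ∀ s ∈ faces, s.map (MulAction.toPerm g).toEmbedding ∈ faces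

variable {Γ : Type*} {W : Type u} [Group Γ] [MulAction Γ W]

/-- The points of the geometric realization: formal convex combinations `∑ λ_v v` of the vertices
of a simplex, given by their barycentric coordinates. -/
@[ext]
structure Realization (K : GComplex Γ W) where
  coord : W →₀ ℝ
  nonneg : ∀ v, 0 ≤ coord v
  sum_eq_one : (coord.sum fun _ t => t) = 1
  support_mem : coord.support ∈ K.faces

namespace Realization

variable (K : GComplex Γ W)

/-- The closed simplex spanned by a set of vertices. -/
def closedSimplex (s : Finset W) : Set (Realization K) := {x | x.coord.support ⊆ s}

/-- The weak topology: each closed simplex carries the Euclidean topology of its barycentric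
coordinates, and the realization carries the finest topology for which the inclusions of all the
closed simplices are continuous. -/
instance : TopologicalSpace (Realization K) :=
  ⨆ s : K.faces, TopologicalSpace.coinduced
    (Subtype.val : closedSimplex K (s : Finset W) → Realization K)
    (TopologicalSpace.induced (fun x (v : W) => x.1.coord v) Pi.topologicalSpace)

variable {K}

/-- The simplicial action `g • ∑ λ_v v = ∑ λ_v (g • v)`. -/
instance : SMul Γ (Realization K) where
  smul g x :=
    { coord := x.coord.equivMapDomain (MulAction.toPerm g)
      nonneg := fun v => by simpa [Finsupp.equivMapDomain_apply] using x.nonneg _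
      sum_eq_one := by
        rw [Finsupp.sum_equivMapDomain]
        exact x.sum_eq_one
      support_mem := K.smul_mem g _ x.support_mem }

lemma smul_coord (g : Γ) (x : Realization K) (v : W) : (g • x).coord v = x.coord (g⁻¹ • v) := rfl

instance : MulAction Γ (Realization K) where
  one_smul x := by
    ext v
    simp [smul_coord]
  mul_smul g h x := by
    ext v
    simp [smul_coord, mul_smul]

end Realization

/-! ### Block-diagonal Fredholm representations -/

/-- The data of a Fredholm representation `ρ = (T, Φ)` of `Γ` on `H = ⨁_{g ∈ Γ} V_g`, `V_g = V`,
where `T` is the sum of copies of the regular representation, `T_h : V_g → V_{hg}`, and `Φ` is the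
block-diagonal operator with blocks `F g : V_g → V_g`. The first condition is the Fredholm
condition on `Φ`, the second one is the compactness of `Φ T_h - T_h Φ`; here `|g| → ∞` means
that `g` leaves every finite subset of `Γ`. -/
structure BlockFredholmRep (Γ : Type*) [Group Γ] (V : Type w) [NormedAddCommGroup V]
    [InnerProductSpace ℂ V] where
  F : Γ → V →L[ℂ] V
  bounded : ∃ (C : ℝ) (S : Set Γ), S.Finite ∧ ∀ g ∉ S, ‖F g‖ ≤ C ∧
    ∃ G : V →L[ℂ] V, G ∘L F g = ContinuousLinearMap.id ℂ V ∧
      F g ∘L G = ContinuousLinearMap.id ℂ V ∧ ‖G‖ ≤ C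
  asymptotic : ∀ h : Γ, Tendsto (fun g => ‖F g - F (h * g)‖) cofinite (𝓝 0)

/-- The interpolated family `F_x = ∑ λ_v F(h_v⁻¹)` for `x = ∑ λ_v v`, where the vertex `v` is
written as `v = h_v x_i` with `x_i` in a chosen system of representatives of the vertex orbits. -/
def BlockFredholmRep.interp {V : Type w} [NormedAddCommGroup V] [InnerProductSpace ℂ V]
    (ρ : BlockFredholmRep Γ V) (h : W → Γ) {K : GComplex Γ W} (x : Realization K) : V →L[ℂ] V :=
  x.coord.sum fun v t => (t : ℂ) • ρ.F (h v)⁻¹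

end FredholmK

end

/-! Continuity is checked on closed simplices, where `F_x` is a finite sum with coefficients linear
in the barycentric coordinates. For invertibility, the choice of vertex representatives makes `h`
equivariant: `h (g • v) = g * h v`. Thus on a translate `g • s` of a fixed simplex the blocks
entering `F_x` are `F ((h v)⁻¹ * g⁻¹)` with `v ∈ s`, and condition 2 puts them all near `F g⁻¹` once
`g` leaves a finite set. Condition 1 bounds the inverse of `F g⁻¹`, so `F_x` is invertible on all
but finitely many translates of `s` (`eventually_bijective_interp`). The topological input is
`exists_finite_faces`: over a compact `X`, finitely many simplices and their translates suffice. The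
bad points then lie in a finite union of compact simplices. Compatibility of the classes is formal,
since restricting the triple only restricts `F_x`. -/

open Pointwise

namespace FredholmK

/-! ### Weak topology of the realization: closed sets and compact simplices. -/

namespace Realization

variable {Γ : Type*} {W : Type u} [Group Γ] [MulAction Γ W] {K : GComplex Γ W}

/-- A map out of the realization is continuous as soon as it is continuous on closed simplices. -/
lemma continuous_of_closedSimplex {X : Type*} [TopologicalSpace X] {f : Realization K → X}
    (hf : ∀ s ∈ K.faces, Continuous[TopologicalSpace.induced
      (fun (x : closedSimplex K s) (v : W) => x.1.coord v) Pi.topologicalSpace, _]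
      fun x : closedSimplex K s => f x.1) : Continuous f :=
  continuous_iSup_dom.2 fun s => continuous_coinduced_dom.2 (hf s.1 s.2)

lemma coord_injective : Function.Injective fun (x : Realization K) (v : W) => x.coord v :=
  fun _ _ h => Realization.ext (DFunLike.coe_injective h)

/-- A set which meets every closed simplex in a finite set is closed. -/
lemma isClosed_of_finite_inter {C : Set (Realization K)}
    (hC : ∀ s ∈ K.faces, (C ∩ closedSimplex K s).Finite) : IsClosed C := by
  refine isClosed_iSup_iff.2 fun s => isClosed_coinduced.2 (isClosed_induced_iff.2 ?_)
  -- A finite set is closed in `W → ℝ`, and injectivity of the coordinates makes its preimage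
  -- exactly the trace of `C` on the simplex.
  refine ⟨(fun (x : Realization K) (v : W) => x.coord v) '' (C ∩ closedSimplex K s.1),
    ((hC s.1 s.2).image _).isClosed, ?_⟩
  ext x
  constructor
  · rintro ⟨y, hy, hxy⟩
    rw [coord_injective hxy] at hy
    exact hy.1
  · exact fun hx => ⟨x.1, ⟨hx, x.2⟩, rfl⟩

lemma support_nonempty (x : Realization K) : x.coord.support.Nonempty :=
  (K.isRelLowerSet_faces x.support_mem).1

/-- The point of a closed simplex with given barycentric coordinates. -/
noncomputable def ofStdSimplex {s : Finset W} (hs : s ∈ K.faces) (y : stdSimplex ℝ s) : closedSimplex K s := by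
  classical
  let c : W →₀ ℝ := Finsupp.onFinset s (fun v => if hv : v ∈ s then y.1 ⟨v, hv⟩ else 0)
    fun v hv => by
      by_contra h
      simp [h] at hv
  have hc : c.support ⊆ s := Finsupp.support_onFinset_subset
  have hsum : (c.sum fun _ t => t) = 1 := by
    rw [Finsupp.sum_of_support_subset c hc _ (by simp), ← Finset.sum_coe_sort s, ← y.2.2]
    exact Finset.sum_congr rfl fun v _ => by simp [c]
  have hne : c.support.Nonempty := by
    rw [Finset.nonempty_iff_ne_empty]
    intro h
    rw [Finsupp.sum, h, Finset.sum_empty] at hsum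
    exact zero_ne_one hsum
  refine ⟨⟨c, fun v => ?_, hsum, (K.isRelLowerSet_faces hs).2 hc hne⟩, hc⟩
  by_cases hv : v ∈ s
  · simpa [c, hv] using y.2.1 ⟨v, hv⟩
  · simp [c, hv]

lemma continuous_ofStdSimplex {s : Finset W} (hs : s ∈ K.faces) :
    Continuous fun y => (ofStdSimplex hs y : Realization K) := by
  have h₁ : Continuous[_, TopologicalSpace.induced
      (fun (x : closedSimplex K s) (v : W) => x.1.coord v) Pi.topologicalSpace]
      (ofStdSimplex hs) := by
    refine continuous_induced_rng.2 (continuous_pi fun v => ?_)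
    by_cases hv : v ∈ s
    · have : Continuous fun y : stdSimplex ℝ s => y.1 ⟨v, hv⟩ :=
        (continuous_apply _).comp continuous_subtype_val
      simpa [ofStdSimplex, Function.comp_def, hv] using this
    · simpa [ofStdSimplex, Function.comp_def, hv] using continuous_const
  have h₂ : Continuous[TopologicalSpace.induced
      (fun (x : closedSimplex K s) (v : W) => x.1.coord v) Pi.topologicalSpace, _]
      (Subtype.val : closedSimplex K s → Realization K) :=
    continuous_iff_coinduced_le.2 (le_iSup (fun s : K.faces => TopologicalSpace.coinduced
      (Subtype.val : closedSimplex K (s : Finset W) → Realization K)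
      (TopologicalSpace.induced (fun x (v : W) => x.1.coord v) Pi.topologicalSpace)) ⟨s, hs⟩)
  exact @Continuous.comp _ _ _ _ (_) _ _ _ h₂ h₁

/-- The closed simplex is the continuous image of the compact `stdSimplex ℝ s`. -/
lemma isCompact_closedSimplex {s : Finset W} (hs : s ∈ K.faces) :
    IsCompact (closedSimplex K s) := by
  classical
  convert isCompact_range (continuous_ofStdSimplex hs)
  ext x
  constructor
  · intro hx
    have hx' : x.coord.support ⊆ s := hx
    refine ⟨⟨fun v => x.coord v, fun v => x.nonneg v, ?_⟩, ?_⟩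
    · rw [Finset.sum_coe_sort s fun v => x.coord v, ← x.sum_eq_one,
        Finsupp.sum_of_support_subset _ hx' _ (by simp)]
    · ext v
      by_cases hv : v ∈ s
      · simp [ofStdSimplex, hv]
      · simpa [ofStdSimplex, hv] using (Finsupp.notMem_support_iff.1 fun h => hv (hx' h)).symm
  · rintro ⟨y, rfl⟩
    exact (ofStdSimplex hs y).2

lemma coe_support_smul (g : Γ) (x : Realization K) :
    ((g • x).coord.support : Set W) = g • (x.coord.support : Set W) := by
  ext v
  simp [Set.mem_smul_set_iff_inv_smul_mem, smul_coord]

/-- The realization of a vertex. -/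
noncomputable def vertex (K : GComplex Γ W) (v : W) : Realization K where
  coord := Finsupp.single v 1
  nonneg w := by
    classical
    rw [Finsupp.single_apply]
    split_ifs <;> simp
  sum_eq_one := by simp
  support_mem := by
    rw [Finsupp.support_single v one_ne_zero]
    exact K.singleton_mem v

lemma smul_vertex (g : Γ) (v : W) : g • vertex K v = vertex K (g • v) := by
  classical
  ext w
  simp [smul_coord, vertex, Finsupp.single_apply, eq_inv_smul_iff]

end Realization

open Realization

/-! ### Orbits of simplices and compact subsets of the base. -/

section Covering

variable {Γ : Type*} {W : Type u} [Group Γ] [MulAction Γ W] {K : GComplex Γ W}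
  {B : Type u'} [TopologicalSpace B] {p : Realization K → B}

/-- Freeness on vertices: `g'⁻¹ * g` fixes a point of the realization, whereas a neighbourhood of
that point is disjoint from its nontrivial translates. -/
lemma eq_of_smul_vertex_eq (hp : IsQuotientCoveringMap p Γ) {g g' : Γ} {v : W}
    (h : g • v = g' • v) : g = g' := by
  obtain ⟨U, hU, hd⟩ := hp.disjoint (vertex K v)
  have hfix : (g'⁻¹ * g) • vertex K v = vertex K v := by
    rw [smul_vertex, mul_smul, h, inv_smul_smul]
  have := hd (g'⁻¹ * g) ⟨vertex K v, ⟨_, mem_of_mem_nhds hU, hfix⟩, mem_of_mem_nhds hU⟩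
  exact (inv_mul_eq_one.1 this).symm

/-- The orbit of the open simplex containing a point. -/
def simplexOrbit (x : Realization K) : MulAction.orbitRel.Quotient Γ (Set W) :=
  Quotient.mk'' (x.coord.support : Set W)

lemma simplexOrbit_smul (g : Γ) (x : Realization K) :
    simplexOrbit (g • x) = simplexOrbit x := by
  rw [simplexOrbit, coe_support_smul]
  exact MulAction.orbitRel.Quotient.quotient_smul_eq

/-- The translates of a family of points from distinct orbits of open simplices form a closed
set. -/
lemma isClosed_translates (hp : IsQuotientCoveringMap p Γ) {T : Type*} (e : T → Realization K)
    (he : Function.Injective fun t => simplexOrbit (e t)) :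
    IsClosed {y | ∃ (g : Γ) (t : T), y = g • e t} := by
  refine isClosed_of_finite_inter fun s _ => ?_
  have hv : ∀ t, ∃ v, v ∈ (e t).coord.support := fun t => (e t).support_nonempty
  choose v hv using hv
  have hy : ∀ y : {y | ∃ (g : Γ) (t : T), y = g • e t}, ∃ (g : Γ) (t : T), y.1 = g • e t :=
    fun y => y.2
  choose g t hgt using hy
  rw [← Subtype.image_preimage_coe]
  refine Set.Finite.image _ ?_
  -- A translate `g • e t` inside `s` is encoded by its support and by the image of a chosen vertex
  -- of `e t`, for which `s` leaves finitely many values. The support recovers `t` because the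
  -- orbits are distinct, and the vertex then recovers `g` by freeness.
  refine Set.Finite.of_finite_image (f := fun y => (y.1.coord.support, g y • v (t y))) ?_ ?_
  · refine (s.powerset ×ˢ s).finite_toSet.subset ?_
    rintro _ ⟨y, hys, rfl⟩
    have hys' : y.1.coord.support ⊆ s := hys
    simp only [Finset.coe_product, Set.mem_prod, Finset.mem_coe, Finset.mem_powerset]
    refine ⟨hys', hys' ?_⟩
    rw [← Finset.mem_coe, hgt y, coe_support_smul]
    exact Set.smul_mem_smul_set (hv _)
  · intro y _ y' _ hyy
    obtain ⟨h₁, h₂⟩ := Prod.mk.inj hyy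
    have ht : t y = t y' := he <| by
      change simplexOrbit _ = simplexOrbit _
      rw [← simplexOrbit_smul (g y) (e (t y)), ← simplexOrbit_smul (g y') (e (t y')),
        ← hgt y, ← hgt y', simplexOrbit, h₁]
      rfl
    rw [ht] at h₂
    apply Subtype.ext
    rw [hgt y, hgt y', ht, eq_of_smul_vertex_eq hp h₂]

/-- A compact subset of the base is covered by the images of finitely many closed simplices. -/
lemma exists_finite_faces (hp : IsQuotientCoveringMap p Γ) {X : Set B} (hX : IsCompact X) :
    ∃ S : Set (Finset W), S.Finite ∧ S ⊆ K.faces ∧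
      ∀ x, p x ∈ X → ∃ s ∈ S, ∃ (g : Γ), ∃ y ∈ closedSimplex K s, x = g • y := by
  have hT : ∀ t : simplexOrbit '' (p ⁻¹' X), ∃ x, p x ∈ X ∧ simplexOrbit x = t.1 := fun t => t.2
  choose e heX he using hT
  have hinj : Function.Injective fun t => simplexOrbit (e t) := fun t t' h => by
    simpa [he, Subtype.ext_iff] using h
  -- One point is chosen over `X` for each orbit of open simplices met. Any subset of the chosen
  -- points has closed saturation, so their images form a closed discrete family inside the compact
  -- `X`; hence there are finitely many.
  let _ : TopologicalSpace (simplexOrbit '' (p ⁻¹' X) : Set (MulAction.orbitRel.Quotient Γ _)) := ⊥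
  have : DiscreteTopology
    (simplexOrbit '' (p ⁻¹' X) : Set (MulAction.orbitRel.Quotient Γ _)) := ⟨rfl⟩
  have hemb : IsClosedEmbedding fun t => p (e t) := by
    refine .of_continuous_injective_isClosedMap continuous_of_discreteTopology ?_ ?_
    · intro t t' h
      obtain ⟨g, hg⟩ := hp.apply_eq_iff_mem_orbit.1 h
      refine hinj ?_
      simp only [← hg, simplexOrbit_smul]
    · intro D _
      rw [← hp.toIsQuotientMap.isClosed_preimage]
      convert isClosed_translates hp (fun t : D => e t) (hinj.comp Subtype.val_injective) using 1
      ext y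
      constructor
      · rintro ⟨t, htD, ht⟩
        obtain ⟨g, hg⟩ := hp.apply_eq_iff_mem_orbit.1 ht.symm
        exact ⟨g, ⟨t, htD⟩, hg.symm⟩
      · rintro ⟨g, t, rfl⟩
        exact ⟨t, t.2, (hp.apply_eq_iff_mem_orbit.2 ⟨g, rfl⟩).symm⟩
  have hfin : Finite (simplexOrbit '' (p ⁻¹' X) : Set (MulAction.orbitRel.Quotient Γ _)) := by
    have := hemb.isCompact_preimage hX
    rw [show (fun t => p (e t)) ⁻¹' X = Set.univ from Set.eq_univ_of_forall heX] at this
    exact Set.finite_univ_iff.1 this.finite_of_discrete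
  refine ⟨Set.range fun t => (e t).coord.support, Set.finite_range _, ?_, fun x hx => ?_⟩
  · rintro _ ⟨t, rfl⟩
    exact (e t).support_mem
  · let t : simplexOrbit '' (p ⁻¹' X) := ⟨simplexOrbit x, x, hx, rfl⟩
    obtain ⟨g, hg⟩ := MulAction.orbitRel_apply.1 (Quotient.exact (he t).symm)
    refine ⟨_, ⟨t, rfl⟩, g, g⁻¹ • x, ?_, (smul_inv_smul g x).symm⟩
    change (g⁻¹ • x).coord.support ⊆ (e t).coord.support
    rw [← Finset.coe_subset, coe_support_smul]
    exact (inv_smul_eq_iff.2 hg.symm).subset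

/-- Both vertices have the same orbit representative, and freeness makes the group coefficient
unique. -/
lemma orbit_coefficient_smul (hp : IsQuotientCoveringMap p Γ) {I : Type*} {x₀ : I → W}
    (hx₀ : ∀ v : W, ∃! i, v ∈ MulAction.orbit Γ (x₀ i)) {h : W → Γ}
    (hh : ∀ v : W, ∃ i, v = h v • x₀ i) (g : Γ) (v : W) : h (g • v) = g * h v := by
  obtain ⟨i, hi⟩ := hh v
  obtain ⟨j, hj⟩ := hh (g • v)
  have hgi : g • v = (g * h v) • x₀ i := by rw [mul_smul, ← hi]
  have hij : j = i := (hx₀ (g • v)).unique ⟨_, hj.symm⟩ ⟨_, hgi.symm⟩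
  subst hij
  exact eq_of_smul_vertex_eq hp (hj.symm.trans hgi)

end Covering

/-! ### Continuity and invertibility of the interpolated family. -/

namespace BlockFredholmRep

variable {Γ : Type*} [Group Γ] {W : Type u} [MulAction Γ W] {K : GComplex Γ W}
  {V : Type w} [NormedAddCommGroup V] [InnerProductSpace ℂ V] (ρ : BlockFredholmRep Γ V)

lemma continuous_interp (h : W → Γ) :
    Continuous fun x : Realization K => ρ.interp h x := by
  refine continuous_of_closedSimplex fun s _ => ?_
  have heq : (fun x : closedSimplex K s => ρ.interp h x.1) =
      (fun c : W → ℝ => ∑ v ∈ s, (c v : ℂ) • ρ.F (h v)⁻¹) ∘ fun x v => x.1.coord v := by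
    ext1 x
    exact Finsupp.sum_of_support_subset _ x.2 _ (by simp)
  rw [heq]
  exact @Continuous.comp _ _ _ (_) _ _ _ _ (by fun_prop) continuous_induced_dom

/-- `F_x` is a convex combination of the blocks at the vertices, and balls are convex. -/
lemma norm_interp_sub_le (h : W → Γ) (x : Realization K) (A : V →L[ℂ] V) {ε : ℝ}
    (hε : ∀ v ∈ x.coord.support, ‖ρ.F (h v)⁻¹ - A‖ ≤ ε) : ‖ρ.interp h x - A‖ ≤ ε := by
  have h₁ : ∑ v ∈ x.coord.support, x.coord v = 1 := x.sum_eq_one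
  have h₂ : ρ.interp h x - A =
      ∑ v ∈ x.coord.support, (x.coord v : ℂ) • (ρ.F (h v)⁻¹ - A) := by
    simp only [smul_sub, Finset.sum_sub_distrib, ← Finset.sum_smul]
    rw [← Complex.ofReal_sum, h₁, Complex.ofReal_one, one_smul]
    rfl
  rw [h₂, ← one_mul ε, ← h₁, Finset.sum_mul]
  refine norm_sum_le_of_le _ fun v hv => ?_
  rw [norm_smul, Complex.norm_real, Real.norm_of_nonneg (x.nonneg v)]
  exact mul_le_mul_of_nonneg_left (hε v hv) (x.nonneg v)

/-- The family `F_x` is uniformly close to `F (g⁻¹)` on the translate `g • s` of a simplex. -/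
lemma eventually_norm_interp_sub_le {h : W → Γ} (hh : ∀ (g : Γ) v, h (g • v) = g * h v)
    (s : Finset W) {ε : ℝ} (hε : 0 < ε) :
    ∀ᶠ g : Γ in cofinite, ∀ y ∈ closedSimplex K s, ‖ρ.interp h (g • y) - ρ.F g⁻¹‖ ≤ ε := by
  have hv : ∀ v ∈ s, ∀ᶠ g : Γ in cofinite, ‖ρ.F (h (g • v))⁻¹ - ρ.F g⁻¹‖ ≤ ε := by
    intro v _
    -- Since `(h (g • v))⁻¹ = (h v)⁻¹ * g⁻¹`, condition 2 applies with the fixed translation `(h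
    -- v)⁻¹` at the argument `g⁻¹`; inversion preserves the cofinite filter.
    have := ((ρ.asymptotic (h v)⁻¹).comp inv_injective.tendsto_cofinite).eventually_le_const hε
    filter_upwards [this] with g hg
    rwa [hh, mul_inv_rev, norm_sub_rev]
  filter_upwards [(Filter.eventually_all_finset s).2 hv] with g hg y hy
  refine ρ.norm_interp_sub_le h _ _ fun w hw => ?_
  have hy' : y.coord.support ⊆ s := hy
  rw [← Finset.mem_coe, coe_support_smul] at hw
  obtain ⟨v, hv, rfl⟩ := hw
  exact hg v (hy' hv)

/-- An operator close to an operator with a left inverse of bounded norm is bijective. -/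
lemma bijective_of_norm_sub_le [FiniteDimensional ℂ V] {A G D : V →L[ℂ] V} {C ε : ℝ}
    (hG : G ∘L A = ContinuousLinearMap.id ℂ V) (hGC : ‖G‖ ≤ C) (hD : ‖D - A‖ ≤ ε)
    (hC : C * ε < 1) : Function.Bijective D := by
  have hinj : Function.Injective (D : V →ₗ[ℂ] V) := by
    refine (injective_iff_map_eq_zero _).2 fun v hv => ?_
    have hv' : D v = 0 := hv
    -- A kernel vector `v` of `D` satisfies `v = G (A v) = -G ((D - A) v)`, so `‖v‖ ≤ C * ε * ‖v‖`
    -- forces `v = 0`.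
    have h₁ : v = -G ((D - A) v) := by
      have : G (A v) = v := DFunLike.congr_fun hG v
      simp [hv', this]
    have hC₀ : 0 ≤ C := (norm_nonneg G).trans hGC
    have h₂ : ‖v‖ ≤ C * ε * ‖v‖ := by
      calc ‖v‖ = ‖G ((D - A) v)‖ := by rw [← norm_neg (G _), ← h₁]
        _ ≤ C * ‖(D - A) v‖ := G.le_of_opNorm_le hGC _
        _ ≤ C * (ε * ‖v‖) := mul_le_mul_of_nonneg_left ((D - A).le_of_opNorm_le hD v) hC₀
        _ = C * ε * ‖v‖ := by ring
    by_contra hne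
    have := norm_pos_iff.2 hne
    nlinarith
  exact ⟨hinj, LinearMap.injective_iff_surjective.1 hinj⟩

lemma eventually_bijective_interp [FiniteDimensional ℂ V] {h : W → Γ}
    (hh : ∀ (g : Γ) v, h (g • v) = g * h v) (s : Finset W) :
    ∀ᶠ g : Γ in cofinite, ∀ y ∈ closedSimplex K s, Function.Bijective (ρ.interp h (g • y)) := by
  obtain ⟨C, S, hS, hC⟩ := ρ.bounded
  -- This tolerance gives `|C| * ε < 1` whatever the sign of `C`.
  have hpos : 0 < (|C| + 1)⁻¹ := by positivity
  have hS' : ∀ᶠ g : Γ in cofinite, g⁻¹ ∉ S :=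
    inv_injective.tendsto_cofinite.eventually hS.eventually_cofinite_notMem
  filter_upwards [hS', ρ.eventually_norm_interp_sub_le (K := K) hh s hpos] with g hg hle y hy
  obtain ⟨-, G, hG, -, hGC⟩ := hC _ hg
  refine bijective_of_norm_sub_le hG (hGC.trans (le_abs_self C)) (hle y hy) ?_
  rw [← div_eq_mul_inv, div_lt_one (by positivity)]
  linarith

lemma exists_isCompact_bijective_interp [FiniteDimensional ℂ V] {B : Type u'} [TopologicalSpace B]
    {p : Realization K → B} (hp : IsQuotientCoveringMap p Γ) {h : W → Γ}
    (hh : ∀ (g : Γ) v, h (g • v) = g * h v) {X : Set B} (hX : IsCompact X) (hX' : IsClosed X) :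
    ∃ L : Set (p ⁻¹' X), IsCompact L ∧ ∀ x ∉ L, Function.Bijective (ρ.interp h x.1) := by
  obtain ⟨S, hS, hSK, hcov⟩ := exists_finite_faces hp hX
  have := hp.toContinuousConstSMul
  -- The exceptional group elements, finite in number because `S` is finite; a point where `F_x`
  -- fails to be bijective can only lie in a translate by one of them.
  let R : Set Γ := {g | ¬ ∀ s ∈ S, ∀ y ∈ closedSimplex K s,
    Function.Bijective (ρ.interp h (g • y))}
  have hR : R.Finite :=
    (Filter.eventually_all_finite hS).2 fun s _ => ρ.eventually_bijective_interp hh s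
  let L : Set (Realization K) := ⋃ g ∈ R, ⋃ s ∈ S, g • closedSimplex K s
  have hL : IsCompact L := hR.isCompact_biUnion fun g _ => hS.isCompact_biUnion fun s hs =>
    (isCompact_closedSimplex (hSK hs)).smul g
  -- `L` need not lie over `X`; its trace on `p ⁻¹' X` is compact because `X` is closed.
  refine ⟨Subtype.val ⁻¹' L,
    (hX'.preimage hp.continuous).isClosedEmbedding_subtypeVal.isCompact_preimage hL, ?_⟩
  rintro ⟨x, hx⟩ hxL
  obtain ⟨s, hs, g, y, hy, rfl⟩ := hcov x hx
  by_contra hb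
  refine hxL (Set.mem_biUnion (x := g) (fun H => hb (H s hs y hy)) ?_)
  exact Set.mem_biUnion hs (Set.smul_mem_smul_set hy)

end BlockFredholmRep

end FredholmK

/-! ### The element of the inverse limit. -/

theorem mainTheorem3
    {Γ : Type*} [Group Γ]
    -- the simplicial space `Eπ` with its simplicial action of the group, and the covering onto `Bπ`
    {W : Type u} [MulAction Γ W] (K : FredholmK.GComplex Γ W)
    [ContractibleSpace (FredholmK.Realization K)]
    {B : Type u'} [TopologicalSpace B] [T2Space B]
    (p : C(FredholmK.Realization K, B)) (hp : IsQuotientCoveringMap p Γ)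
    -- one vertex from each orbit, and the resulting expressions `v = h_v x_i`
    {I : Type*} (x₀ : I → W) (hx₀ : ∀ v : W, ∃! i, v ∈ MulAction.orbit Γ (x₀ i))
    (h : W → Γ) (hh : ∀ v : W, ∃ i, v = h v • x₀ i)
    {V : Type w} [NormedAddCommGroup V] [InnerProductSpace ℂ V] [FiniteDimensional ℂ V]
    (ρ : FredholmK.BlockFredholmRep Γ V) :
    ∃ (hc : Continuous fun x : FredholmK.Realization K => ρ.interp h x)
      (hs : ∀ X : TopologicalSpace.Compacts B, ∃ L : Set (p ⁻¹' (X : Set B)), IsCompact L ∧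
        ∀ x ∉ L, Function.Bijective (ρ.interp h x.1)),
      ∃! κ : FredholmK.KLim.{u, u', w} p, ∀ X : TopologicalSpace.Compacts B,
        κ.1 X = FredholmK.Kc.mk (FredholmK.Triple.ofMap
          ⟨fun x : p ⁻¹' (X : Set B) => ρ.interp h x.1, hc.comp continuous_subtype_val⟩
          (hs X)) := by
  have hh' := FredholmK.orbit_coefficient_smul hp hx₀ hh
  have hc := ρ.continuous_interp (K := K) h
  have hs : ∀ X : TopologicalSpace.Compacts B, ∃ L : Set (p ⁻¹' (X : Set B)), IsCompact L ∧
      ∀ x ∉ L, Function.Bijective (ρ.interp h x.1) := fun X =>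
    ρ.exists_isCompact_bijective_interp hp hh' X.isCompact X.isCompact.isClosed
  -- The pulled-back triple over a smaller compact set is definitionally the triple built there, so
  -- `Kc.map_mk` is the whole compatibility proof. Uniqueness holds because a compatible family is
  -- determined by its components.
  refine ⟨hc, hs, ⟨fun X => FredholmK.Kc.mk (FredholmK.Triple.ofMap
    ⟨fun x : p ⁻¹' (X : Set B) => ρ.interp h x.1, hc.comp continuous_subtype_val⟩ (hs X)),
    fun X X' hX => FredholmK.Kc.map_mk _ _ _⟩, fun X => rfl, fun κ hκ => ?_⟩
  exact Subtype.ext (funext hκ)
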